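/- Let $\Gamma$ be a finite simple graph with vertex set $V(\Gamma)$ and edge set $E(\Gamma)$, where $V(\Gamma)$ is nonempty and $|V(\Gamma)| \neq 2$, and let $F$ be a field. Let \[A(\Gamma)=\langle V(\Gamma)\mid vwv^{-1}w^{-1}=1 \text{ for all } \{v,w\}\in E(\Gamma)\rangle\] be the right-angled Artin group on $\Gamma$, let $V=H^1(A(\Gamma),F)$ and $W=H^2(A(\Gamma),F)$ be its group cohomology with trivial coefficients in $F$, and let $q\colon V\times V\to W$ be the cup product pairing. A bilinear pairing $q\colon V\times V\to W$ of $F$-vector spaces with $V$ finite-dimensional is called cyclic Hamiltonian if for every basis $\{w_1,\dots,w_n\}$ of $V$ there is a permutation $\sigma\in S_n$ such that $q(w_{\sigma(i)},w_{\sigma(i+1)})\neq 0$ for all $1\le i\le n$, where indices are taken cyclically (so $n+1$ means $1$). Then $\Gamma$ has a Hamiltonian cycle (a cycle in $\Gamma$, necessarily of length at least $3$, that visits every vertex exactly once) if and only if $(V,W,q)$ is cyclic Hamiltonian. -/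

import Mathlib

universe u

/-- The defining relators of the right-angled Artin group on `Γ`: the commutators of pairs of
adjacent vertices. -/
def raagRels {V : Type u} (Γ : SimpleGraph V) : Set (FreeGroup V) :=
  {r | ∃ v w : V, Γ.Adj v w ∧
    r = FreeGroup.of v * FreeGroup.of w * (FreeGroup.of v)⁻¹ * (FreeGroup.of w)⁻¹}

/-- The right-angled Artin group `A(Γ) = ⟨V(Γ) ∣ [v, w] = 1 for {v, w} ∈ E(Γ)⟩`. -/
abbrev RAAG {V : Type u} (Γ : SimpleGraph V) : Type u :=
  PresentedGroup (raagRels Γ)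

section CupProduct

variable (F G : Type u) [Field F] [Group G]

/-- `H¹(G, F)`: group cohomology with coefficients in the trivial representation `F`. -/
noncomputable abbrev cohomologyOne : ModuleCat F :=
  groupCohomology.H1 (Rep.trivial F G F)

/-- `H²(G, F)`: group cohomology with coefficients in the trivial representation `F`. -/
noncomputable abbrev cohomologyTwo : ModuleCat F :=
  groupCohomology.H2 (Rep.trivial F G F)

variable {F G}

/-- The cup product of two inhomogeneous `1`-cocycles with trivial coefficients: the
`2`-cocycle `(g, h) ↦ x g * y h`. -/
def cupCocycle (x y : groupCohomology.cocycles₁ (Rep.trivial F G F)) :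
    groupCohomology.cocycles₂ (Rep.trivial F G F) :=
  ⟨fun p => (x.1 p.1 * y.1 p.2 : F), by
    have hx : ∀ g h : G, (x.1 (g * h) : F) = x.1 g + x.1 h :=
      groupCohomology.cocycles₁_map_mul_of_isTrivial x
    have hy : ∀ g h : G, (y.1 (g * h) : F) = y.1 g + y.1 h :=
      groupCohomology.cocycles₁_map_mul_of_isTrivial y
    rw [groupCohomology.mem_cocycles₂_iff]
    intro g h j
    change ((x.1 (g * h) : F) * y.1 j + x.1 g * y.1 h : F)
      = x.1 h * y.1 j + x.1 g * y.1 (h * j)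
    rw [hx, hy]
    ring⟩

variable (F G) in
/-- The cocycle representing a class in `H¹(G, F)` (unique, since all `1`-coboundaries with
trivial coefficients vanish). -/
noncomputable def cocycleRep :
    cohomologyOne F G →ₗ[F] groupCohomology.cocycles₁ (Rep.trivial F G F) :=
  (groupCohomology.cocycles₁IsoOfIsTrivial (Rep.trivial F G F)).inv.hom ∘ₗ
    (groupCohomology.H1IsoOfIsTrivial (Rep.trivial F G F)).hom.hom

variable (F G) in
/-- The cup product pairing `H¹(G, F) × H¹(G, F) → H²(G, F)`. -/
noncomputable def cupProduct :
    cohomologyOne F G →ₗ[F] cohomologyOne F G →ₗ[F] cohomologyTwo F G :=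
  LinearMap.mk₂ F
    (fun x y => (groupCohomology.H2π (Rep.trivial F G F)).hom
      (cupCocycle (cocycleRep F G x) (cocycleRep F G y)))
    (fun x x' y => by
      rw [← map_add, map_add]
      exact congrArg _ (Subtype.ext (funext fun p => add_mul (R := F) _ _ _)))
    (fun c x y => by
      rw [← map_smul, map_smul]
      exact congrArg _ (Subtype.ext (funext fun p => mul_assoc (G := F) _ _ _)))
    (fun x y y' => by
      rw [← map_add, map_add]
      exact congrArg _ (Subtype.ext (funext fun p => mul_add (R := F) _ _ _)))
    (fun c x y => by
      rw [← map_smul, map_smul]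
      exact congrArg _ (Subtype.ext (funext fun p => mul_left_comm (G := F) _ _ _)))

/-- `[x] ⌣ [y]` is the class of the cocycle `(g, h) ↦ x g * y h`. -/
theorem cupProduct_H1π (x y : groupCohomology.cocycles₁ (Rep.trivial F G F)) :
    cupProduct F G ((groupCohomology.H1π (Rep.trivial F G F)).hom x)
        ((groupCohomology.H1π (Rep.trivial F G F)).hom y)
      = (groupCohomology.H2π (Rep.trivial F G F)).hom (cupCocycle x y) := by
  have key : ∀ z : groupCohomology.cocycles₁ (Rep.trivial F G F),
      cocycleRep F G ((groupCohomology.H1π (Rep.trivial F G F)).hom z) = z := by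
    intro z
    apply Subtype.ext
    funext g
    exact groupCohomology.H1IsoOfIsTrivial_H1π_apply_apply
      (A := Rep.trivial F G F) z (Additive.ofMul g)
  simp only [cupProduct, LinearMap.mk₂_apply, key]

end CupProduct

/-- A bilinear pairing `q : V × V → W` on a finite-dimensional vector space `V` is cyclic
Hamiltonian if every basis of `V` can be reordered so that `q` is nonzero on all cyclically
consecutive pairs of basis vectors, `finRotate n` being the cyclic successor
`0 ↦ 1 ↦ ⋯ ↦ n - 1 ↦ 0` on `Fin n`. -/
def IsCyclicHamiltonian {F V W : Type*} [Field F] [AddCommGroup V] [Module F V]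
    [AddCommGroup W] [Module F W] (q : V →ₗ[F] V →ₗ[F] W) : Prop :=
  FiniteDimensional F V ∧
    ∀ (n : ℕ) (w : Module.Basis (Fin n) F V), ∃ σ : Equiv.Perm (Fin n),
      ∀ i : Fin n, q (w (σ i)) (w (σ (finRotate n i))) ≠ 0

/-!
Write `A = A(Γ)` and identify `H¹(A, F) = Hom(A, F)` with the space `F^V` of functions on the
vertices by restricting homomorphisms to the generators.

**The cup product.** For `x, y ∈ F^V`, the class `x ⌣ y` vanishes if and only if the minor
`x u * y v - x v * y u` vanishes for every edge `uv` of `Γ` (`cupProduct_eq_zero_iff`). If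
`x g * y h = f h - f (g * h) + f g`, then exchanging two commuting elements `g = u`, `h = v` leaves
the right-hand side unchanged, so the minor at `uv` is zero. Conversely, the elements `(x u, y u, 0)`
of the Heisenberg group over `F` have commutators `(0, 0, x u * y v - x v * y u)`; if these vanish on
edges, the elements define a homomorphism from `A` to the Heisenberg group, and its last coordinate
is, up to sign, a cochain with coboundary `x ⌣ y`.

**Cyclic Hamiltonian implies Hamiltonian.** In the basis of `F^V` dual to the vertices, two distinct
basis vectors have a nonzero cup product exactly when the vertices are adjacent, so a cyclic order
on this basis as in the definition is a Hamiltonian cycle.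

**Hamiltonian implies cyclic Hamiltonian.** More is true, for every graph `Γ`: the vectors of any
basis of `F^V` can be indexed by the vertices so that vectors at adjacent vertices have a nonzero
cup product (`exists_perm_not_minorsVanish`). Think of the basis as the rows of a matrix with
nonzero determinant. If the support of a row is not connected in `Γ`, split the row as `a + b` with
no edge between the supports of `a` and `b`. The determinant is linear in that row, so replacing
the row by one of `a`, `b` keeps it nonzero; and all cup products with the row that were zero stay
zero, because each of `a`, `b` agrees with the row on every edge that meets its support. So all
supports may be assumed connected. Then two rows with zero cup product, which are not proportional,
have supports with no edge between them (`MinorsVanish.exists_eq_smul`). A nonzero term of the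
expansion of the determinant is a bijection from vertices to rows that sends each vertex to a row
whose support contains it, and this bijection has the required property.
-/

/-! ### Bases of the space of functions on the vertices -/

section Minors

variable {V F : Type*} [Field F] {Γ : SimpleGraph V}

/-- All `2 × 2` minors of the pair of rows `x`, `y` at the edges of `Γ` vanish. -/
def MinorsVanish (Γ : SimpleGraph V) (x y : V → F) : Prop :=
  ∀ u v, Γ.Adj u v → x u * y v = x v * y u

theorem MinorsVanish.symm {x y : V → F} (h : MinorsVanish Γ x y) : MinorsVanish Γ y x :=
  fun u v huv => by rw [mul_comm, ← h u v huv, mul_comm]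

/-- No edge of `Γ` inside the support of `x` joins `S` to its complement: the restrictions of `x`
to `S` and to `Sᶜ` have supports with no edge between them. -/
def Separates (Γ : SimpleGraph V) (S : Set V) (x : V → F) : Prop :=
  ∀ u ∈ S, ∀ v ∉ S, Γ.Adj u v → x u = 0 ∨ x v = 0

theorem Separates.compl {S : Set V} {x : V → F} (h : Separates Γ S x) : Separates Γ Sᶜ x :=
  fun u hu v hv huv => (h v (not_not.1 hv) u hu huv.symm).symm

/-- The support of `x` is connected in `Γ` (or empty): it lies on one side of every set that
separates it. -/
def ConnectedSupport (Γ : SimpleGraph V) (x : V → F) : Prop :=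
  ∀ S : Set V, Separates Γ S x → (∃ u ∈ S, x u ≠ 0) → ∀ v ∉ S, x v = 0

theorem MinorsVanish.indicator {S : Set V} {x y : V → F} (hS : Separates Γ S x)
    (h : MinorsVanish Γ x y) : MinorsVanish Γ (S.indicator x) y := by
  intro u v huv
  have huv' := h u v huv
  by_cases hu : u ∈ S <;> by_cases hv : v ∈ S
  · simpa [hu, hv] using huv'
  · rcases hS u hu v hv huv with h0 | h0 <;> simp_all
  · rcases hS v hv u hu huv.symm with h0 | h0 <;> simp_all
  · simp [hu, hv]

/-- If the minors of `x` and `y` vanish and an edge joins the supports, then the ratio `y / x` is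
constant along the edges inside either support; so connected supports force `x` and `y` to be
proportional. -/
theorem MinorsVanish.exists_eq_smul {x y : V → F} (h : MinorsVanish Γ x y)
    (hx : ConnectedSupport Γ x) (hy : ConnectedSupport Γ y) {u v : V} (huv : Γ.Adj u v)
    (hu : x u ≠ 0) (hv : y v ≠ 0) : ∃ c : F, y = c • x := by
  have hyu : y u ≠ 0 := by
    intro h0
    have := h u v huv
    simp_all
  set c := y u / x u with hc
  set S : Set V := {w | y w = c * x w} with hSdef
  have huS : u ∈ S := by
    change y u = c * x u
    rw [hc, div_mul_cancel₀ _ hu]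
  have key : ∀ w ∈ S, ∀ w' ∉ S, Γ.Adj w w' → x w = 0 := by
    intro w hw w' hw' hadj
    by_contra h0
    apply hw'
    have hw : y w = c * x w := hw
    have h1 := h w w' hadj
    rw [hw] at h1
    change y w' = c * x w'
    apply mul_left_cancel₀ h0
    rw [h1]
    ring
  have hSx : Separates Γ S x := fun w hw w' hw' hadj => Or.inl (key w hw w' hw' hadj)
  have hSy : Separates Γ S y := fun w hw w' hw' hadj => by
    have hyw : y w = c * x w := hw
    exact Or.inl (by rw [hyw, key w hw w' hw' hadj, mul_zero])
  refine ⟨c, funext fun w => ?_⟩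
  by_contra hw
  have hw : w ∉ S := hw
  have h1 := hx S hSx ⟨u, huS, hu⟩ w hw
  have h2 := hy S hSy ⟨u, huS, hyu⟩ w hw
  exact hw (by change y w = c * x w; rw [h1, h2, mul_zero])

theorem card_support_indicator_lt [Fintype V] {S : Set V} {x : V → F} {v : V} (hv : v ∉ S)
    (hxv : x v ≠ 0) : (Function.support (S.indicator x)).ncard < (Function.support x).ncard := by
  refine Set.ncard_lt_ncard ⟨?_, fun h => ?_⟩ (Set.toFinite _)
  · rw [Set.support_indicator]
    exact Set.inter_subset_right
  · have := h (show v ∈ Function.support x from hxv)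
    simp [hv] at this

/-- For rows with connected support, any permutation that contributes a nonzero term to the
determinant has the property of `exists_perm_not_minorsVanish`. -/
theorem exists_perm_not_minorsVanish_of_connectedSupport [Fintype V] [DecidableEq V]
    (M : Matrix V V F) (hM : M.det ≠ 0) (hconn : ∀ i, ConnectedSupport Γ (M i)) :
    ∃ σ : Equiv.Perm V, ∀ v w, Γ.Adj v w → ¬ MinorsVanish Γ (M (σ v)) (M (σ w)) := by
  obtain ⟨σ, hσ⟩ : ∃ σ : Equiv.Perm V, ∀ v, M (σ v) v ≠ 0 := by
    by_contra! hcon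
    refine hM ?_
    rw [Matrix.det_apply]
    refine Finset.sum_eq_zero fun σ _ => ?_
    obtain ⟨v, hv⟩ := hcon σ
    have h0 : ∏ i, M (σ i) i = 0 := Finset.prod_eq_zero (Finset.mem_univ v) hv
    exact (congrArg (Equiv.Perm.sign σ • ·) h0).trans (smul_zero _)
  refine ⟨σ, fun v w hvw h => ?_⟩
  obtain ⟨c, hc⟩ := h.exists_eq_smul (hconn _) (hconn _) hvw (hσ v) (hσ w)
  have hne : σ w ≠ σ v := fun h0 => hvw.ne (σ.injective h0).symm
  apply hM
  rw [← Matrix.updateRow_eq_self M (σ w)]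
  rw [show M (σ w) = c • M (σ v) from hc, Matrix.det_updateRow_smul,
    Matrix.det_updateRow_eq_zero hne.symm, mul_zero]

/-- The rows of an invertible matrix with columns indexed by the vertices of a graph `Γ` can be
assigned bijectively to the vertices so that rows at adjacent vertices have a nonzero minor at some
edge of `Γ`. The proof is by induction on the total size of the supports of the rows, splitting a
row with disconnected support. -/
theorem exists_perm_not_minorsVanish [Fintype V] [DecidableEq V] (Γ : SimpleGraph V)
    (M : Matrix V V F) (hM : M.det ≠ 0) :
    ∃ σ : Equiv.Perm V, ∀ v w, Γ.Adj v w → ¬ MinorsVanish Γ (M (σ v)) (M (σ w)) := by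
  induction hN : ∑ i, (Function.support (M i)).ncard using Nat.strong_induction_on
    generalizing M with
  | _ N ih =>
    by_cases hconn : ∀ i, ConnectedSupport Γ (M i)
    · exact exists_perm_not_minorsVanish_of_connectedSupport M hM hconn
    simp only [ConnectedSupport, not_forall] at hconn
    obtain ⟨i, S, hS, ⟨u, hu, hxu⟩, v, hv, hxv⟩ := hconn
    -- One of the two restrictions of row `i` can replace it without losing invertibility.
    obtain ⟨T, hT, hTdet, w, hw, hxw⟩ : ∃ T : Set V, Separates Γ T (M i) ∧
        (M.updateRow i (T.indicator (M i))).det ≠ 0 ∧ ∃ w ∉ T, M i w ≠ 0 := by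
      by_cases hd : (M.updateRow i (S.indicator (M i))).det = 0
      · refine ⟨Sᶜ, hS.compl, fun hd' => hM ?_, u, not_not.2 hu, hxu⟩
        rw [← Matrix.updateRow_eq_self M i, ← Set.indicator_self_add_compl S (M i),
          Matrix.det_updateRow_add, hd, hd', add_zero]
      · exact ⟨S, hS, hd, v, hv, hxv⟩
    have hlt := card_support_indicator_lt hw hxw
    obtain ⟨σ, hσ⟩ := ih _ (by
      rw [← hN]
      refine Finset.sum_lt_sum (fun j _ => ?_) ⟨i, Finset.mem_univ i, ?_⟩
      · by_cases hj : j = i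
        · subst hj
          simpa using hlt.le
        · rw [Matrix.updateRow_ne hj]
      · simpa using hlt) (M.updateRow i (T.indicator (M i))) hTdet rfl
    refine ⟨σ, fun a b hab h => hσ a b hab ?_⟩
    have hne : σ a ≠ σ b := fun h0 => hab.ne (σ.injective h0)
    by_cases ha : σ a = i
    · have hb : σ b ≠ i := fun h0 => hne (ha.trans h0.symm)
      rw [ha] at h ⊢
      rw [Matrix.updateRow_self, Matrix.updateRow_ne hb]
      exact h.indicator hT
    · rw [Matrix.updateRow_ne ha]
      by_cases hb : σ b = i
      · rw [hb] at h ⊢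
        rw [Matrix.updateRow_self]
        exact (h.symm.indicator hT).symm
      · rwa [Matrix.updateRow_ne hb]

end Minors

/-! ### The Heisenberg group -/

/-- The Heisenberg group over `R`, as triples `(a, b, c)` standing for the upper unitriangular
matrices with first row `1, a, c` and second row `0, 1, b`. -/
@[ext]
structure HeisenbergGroup (R : Type*) where
  /-- The entry in position `(1, 2)`. -/
  a : R
  /-- The entry in position `(2, 3)`. -/
  b : R
  /-- The entry in position `(1, 3)`. -/
  c : R

namespace HeisenbergGroup

variable {R : Type*} [CommRing R]

instance : Mul (HeisenbergGroup R) := ⟨fun x y => ⟨x.a + y.a, x.b + y.b, x.c + y.c + x.a * y.b⟩⟩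
instance : One (HeisenbergGroup R) := ⟨⟨0, 0, 0⟩⟩
instance : Inv (HeisenbergGroup R) := ⟨fun x => ⟨-x.a, -x.b, -x.c + x.a * x.b⟩⟩

@[simp] theorem mul_a (x y : HeisenbergGroup R) : (x * y).a = x.a + y.a := rfl
@[simp] theorem mul_b (x y : HeisenbergGroup R) : (x * y).b = x.b + y.b := rfl
@[simp] theorem mul_c (x y : HeisenbergGroup R) : (x * y).c = x.c + y.c + x.a * y.b := rfl
@[simp] theorem one_a : (1 : HeisenbergGroup R).a = 0 := rfl
@[simp] theorem one_b : (1 : HeisenbergGroup R).b = 0 := rfl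
@[simp] theorem one_c : (1 : HeisenbergGroup R).c = 0 := rfl
@[simp] theorem inv_a (x : HeisenbergGroup R) : x⁻¹.a = -x.a := rfl
@[simp] theorem inv_b (x : HeisenbergGroup R) : x⁻¹.b = -x.b := rfl
@[simp] theorem inv_c (x : HeisenbergGroup R) : x⁻¹.c = -x.c + x.a * x.b := rfl

instance : Group (HeisenbergGroup R) :=
  Group.ofLeftAxioms
    (fun x y z => by ext <;> simp <;> ring)
    (fun x => by ext <;> simp)
    (fun x => by ext <;> simp)

end HeisenbergGroup

/-! ### Homomorphisms from a right-angled Artin group -/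

section RAAG

variable {V : Type u} {Γ : SimpleGraph V}

/-- The homomorphism from `A(Γ)` given by images of the vertices that commute along edges. -/
def raagLift {G : Type*} [Group G] (f : V → G)
    (hf : ∀ v w, Γ.Adj v w → f v * f w = f w * f v) : RAAG Γ →* G :=
  PresentedGroup.toGroup (f := f) (by
    rintro _ ⟨v, w, hvw, rfl⟩
    simp [hf v w hvw])

theorem raagLift_of {G : Type*} [Group G] (f : V → G)
    (hf : ∀ v w, Γ.Adj v w → f v * f w = f w * f v) (v : V) :
    raagLift f hf (PresentedGroup.of v) = f v :=
  PresentedGroup.toGroup.of _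

theorem raag_of_mul_comm {v w : V} (h : Γ.Adj v w) :
    (PresentedGroup.of v * PresentedGroup.of w : RAAG Γ)
      = PresentedGroup.of w * PresentedGroup.of v := by
  have := PresentedGroup.one_of_mem (rels := raagRels Γ) ⟨v, w, h, rfl⟩
  rw [map_mul, map_mul, map_mul, map_inv, map_inv, mul_inv_eq_one, mul_inv_eq_iff_eq_mul] at this
  exact this

/-- Additive homomorphisms from `A(Γ)` to `F` are the functions on the vertices. -/
def raagAddHomEquiv (Γ : SimpleGraph V) (F : Type u) [Field F] :
    (Additive (RAAG Γ) →+ F) ≃ₗ[F] (V → F) where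
  toFun f v := f (Additive.ofMul (PresentedGroup.of v))
  map_add' _ _ := rfl
  map_smul' _ _ := rfl
  invFun x := MonoidHom.toAdditiveLeft (raagLift (fun v => Multiplicative.ofAdd (x v))
    fun _ _ _ => mul_comm _ _)
  left_inv f := by
    apply MonoidHom.toAdditiveLeft.symm.injective
    rw [Equiv.symm_apply_apply]
    apply PresentedGroup.ext
    intro v
    rw [raagLift_of]
    rfl
  right_inv x := by
    funext v
    exact congrArg Multiplicative.toAdd (raagLift_of (Γ := Γ) _ _ v)

theorem raag_addHom_ext {F : Type u} [Field F] {f f' : RAAG Γ → F}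
    (hf : ∀ g h, f (g * h) = f g + f h) (hf' : ∀ g h, f' (g * h) = f' g + f' h)
    (h : ∀ v, f (PresentedGroup.of v) = f' (PresentedGroup.of v)) (g : RAAG Γ) : f g = f' g := by
  have : AddMonoidHom.mk' (fun g : Additive (RAAG Γ) => f g.toMul) (fun _ _ => hf _ _)
      = AddMonoidHom.mk' (fun g : Additive (RAAG Γ) => f' g.toMul) (fun _ _ => hf' _ _) :=
    (raagAddHomEquiv Γ F).injective (funext h)
  exact DFunLike.congr_fun this (Additive.ofMul g)

end RAAG

/-! ### The cup product of a right-angled Artin group -/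

section CupProduct

open groupCohomology

variable {V : Type u} (Γ : SimpleGraph V) (F : Type u) [Field F]

/-- The identification of `H¹(A(Γ), F)` with the functions on the vertices, by evaluating
homomorphisms at the generators. -/
noncomputable def cohomologyOneEquiv : cohomologyOne F (RAAG Γ) ≃ₗ[F] (V → F) :=
  (H1IsoOfIsTrivial (Rep.trivial F (RAAG Γ) F)).toLinearEquiv ≪≫ₗ raagAddHomEquiv Γ F

variable {Γ F}

/-- If the minors of `x` and `y` at the edges vanish, then the last coordinate `c` of the
homomorphism to the Heisenberg group with first two coordinates `x` and `y` exhibits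
`x g * y h` as a coboundary. -/
theorem exists_map_mul_of_minorsVanish
    (x y : cocycles₁ (Rep.trivial F (RAAG Γ) F))
    (h : MinorsVanish Γ (fun v => (x.1 (PresentedGroup.of v) : F))
      (fun v => (y.1 (PresentedGroup.of v) : F))) :
    ∃ c : RAAG Γ → F, ∀ g h, c (g * h) = c g + c h + (x.1 g * y.1 h : F) := by
  have hx : ∀ g h, (x.1 (g * h) : F) = x.1 g + x.1 h := cocycles₁_map_mul_of_isTrivial x
  have hy : ∀ g h, (y.1 (g * h) : F) = y.1 g + y.1 h := cocycles₁_map_mul_of_isTrivial y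
  let φ : RAAG Γ →* HeisenbergGroup F := raagLift
    (fun v => ⟨(x.1 (PresentedGroup.of v) : F), (y.1 (PresentedGroup.of v) : F), 0⟩)
    (fun v w hvw => by
      ext
      · exact add_comm _ _
      · exact add_comm _ _
      · simpa using h v w hvw)
  have ha : ∀ g, (φ g).a = (x.1 g : F) :=
    raag_addHom_ext (fun g h => by rw [map_mul, HeisenbergGroup.mul_a]) hx
      (fun v => congrArg HeisenbergGroup.a (raagLift_of (Γ := Γ) _ _ v))
  have hb : ∀ g, (φ g).b = (y.1 g : F) :=
    raag_addHom_ext (fun g h => by rw [map_mul, HeisenbergGroup.mul_b]) hy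
      (fun v => congrArg HeisenbergGroup.b (raagLift_of (Γ := Γ) _ _ v))
  refine ⟨fun g => (φ g).c, fun g h => ?_⟩
  change (φ (g * h)).c = _
  rw [map_mul, HeisenbergGroup.mul_c, ha, hb]

/-- The cup product of two classes on a right-angled Artin group vanishes exactly when all minors
at the edges do. -/
theorem cupProduct_eq_zero_iff (x y : cohomologyOne F (RAAG Γ)) :
    cupProduct F (RAAG Γ) x y = 0 ↔
      MinorsVanish Γ (cohomologyOneEquiv Γ F x) (cohomologyOneEquiv Γ F y) := by
  change (H2π (Rep.trivial F (RAAG Γ) F)).hom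
    (cupCocycle (cocycleRep F _ x) (cocycleRep F _ y)) = 0 ↔ _
  refine (H2π_eq_zero_iff _).trans ⟨?_, fun h => ?_⟩
  · rintro ⟨f, hf⟩ v w hvw
    have h1 := congrFun hf (PresentedGroup.of v, PresentedGroup.of w)
    have h2 := congrFun hf (PresentedGroup.of w, PresentedGroup.of v)
    change (f (PresentedGroup.of w) - f (PresentedGroup.of v * PresentedGroup.of w)
      + f (PresentedGroup.of v) : F) = cohomologyOneEquiv Γ F x v * cohomologyOneEquiv Γ F y w at h1
    change (f (PresentedGroup.of v) - f (PresentedGroup.of w * PresentedGroup.of v)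
      + f (PresentedGroup.of w) : F) = cohomologyOneEquiv Γ F x w * cohomologyOneEquiv Γ F y v at h2
    rw [← h1, ← h2, raag_of_mul_comm hvw]
    ring
  · obtain ⟨c, hc⟩ := exists_map_mul_of_minorsVanish (cocycleRep F _ x) (cocycleRep F _ y) h
    refine ⟨fun g => (-c g : F), funext fun p => ?_⟩
    change (-c p.2 - -c (p.1 * p.2) + -c p.1 : F)
      = (cocycleRep F _ x).1 p.1 * (cocycleRep F _ y).1 p.2
    rw [hc]
    ring

end CupProduct

/-! ### Hamiltonian cycles -/

/-- A Hamiltonian cycle is a cyclic enumeration of the vertices along edges. For two vertices the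
enumeration would go back and forth along a single edge, which is not a cycle. -/
theorem exists_isHamiltonianCycle_iff {V : Type*} [Fintype V] [DecidableEq V] [Nonempty V]
    (hV : Fintype.card V ≠ 2) (Γ : SimpleGraph V) :
    (∃ (v : V) (p : Γ.Walk v v), p.IsHamiltonianCycle) ↔
      ∃ e : Fin (Fintype.card V) ≃ V, ∀ i, Γ.Adj (e i) (e (finRotate _ i)) := by
  have hpos : 0 < Fintype.card V := Fintype.card_pos
  generalize hn : Fintype.card V = n at *
  rcases Nat.lt_or_ge 2 n with h2 | h2
  · simp_rw [SimpleGraph.Walk.isHamiltonianCycle_iff_isCycle_and_length_eq, hn]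
    rw [← SimpleGraph.cycleGraph_isContained_iff h2]
    obtain ⟨m, rfl⟩ : ∃ m, n = m + 2 := ⟨n - 2, by lia⟩
    constructor
    · rintro ⟨f⟩
      have hbij : Function.Bijective f :=
        (Fintype.bijective_iff_injective_and_card f).2 ⟨f.injective, by simp [hn]⟩
      refine ⟨Equiv.ofBijective f hbij, fun i => f.toHom.map_adj ?_⟩
      rw [SimpleGraph.cycleGraph_adj, finRotate_apply]
      exact Or.inr (add_sub_cancel_left i 1)
    · rintro ⟨e, he⟩
      refine ⟨⟨⟨e, fun {a b} hab => ?_⟩, e.injective⟩⟩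
      rcases hab with hab | hab
      · have := he b
        rw [finRotate_apply, ← hab, add_sub_cancel] at this
        exact this.symm
      · have := he a
        rwa [finRotate_apply, ← hab, add_sub_cancel] at this
  · obtain rfl : n = 1 := by lia
    constructor
    · rintro ⟨v, p, hp⟩
      have := hp.length_eq
      have := hp.isCycle.three_le_length
      lia
    · rintro ⟨e, he⟩
      exact absurd (he 0) (by simp)

theorem theorem1p2 {V F : Type u} [Fintype V] [DecidableEq V] [Nonempty V]
    (hV : Fintype.card V ≠ 2) (Γ : SimpleGraph V) [Field F] :
    (∃ (v : V) (p : Γ.Walk v v), p.IsHamiltonianCycle) ↔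
      IsCyclicHamiltonian (cupProduct F (RAAG Γ)) := by
  rw [exists_isHamiltonianCycle_iff hV]
  simp only [IsCyclicHamiltonian, ne_eq, cupProduct_eq_zero_iff]
  set E := cohomologyOneEquiv Γ F
  constructor
  · rintro ⟨e, he⟩
    refine ⟨Module.Finite.equiv E.symm, fun n w => ?_⟩
    obtain rfl : n = Fintype.card V := by
      have := Module.finrank_eq_card_basis (w.map E)
      simpa using this.symm
    let B : Module.Basis V F (V → F) := (w.map E).reindex e
    have hdet : (Matrix.of fun v => B v).det ≠ 0 := by
      rw [← isUnit_iff_ne_zero, ← Matrix.isUnit_iff_isUnit_det,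
        ← Matrix.linearIndependent_rows_iff_isUnit]
      exact B.linearIndependent
    obtain ⟨σ, hσ⟩ := exists_perm_not_minorsVanish Γ (Matrix.of fun v => B v) hdet
    refine ⟨(e.trans σ).trans e.symm, fun i => ?_⟩
    have hB : ∀ v, Matrix.of (fun v => B v) v = E (w (e.symm v)) := fun v => by
      change B v = _
      simp [B]
    simpa only [hB, Equiv.trans_apply] using hσ _ _ (he i)
  · rintro ⟨-, h⟩
    let e := (Fintype.equivFin V).symm
    let w : Module.Basis (Fin (Fintype.card V)) F (cohomologyOne F (RAAG Γ)) :=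
      ((Pi.basisFun F V).map E.symm).reindex e.symm
    obtain ⟨σ, hσ⟩ := h _ w
    refine ⟨σ.trans e, fun i => ?_⟩
    by_contra hadj
    refine hσ i fun u v huv => ?_
    have hw : ∀ j, E (w j) = Pi.single (e j) 1 := fun j => by simp [w]
    rw [hw, hw]
    -- The minor of two dual basis vectors at an edge `uv` can be nonzero only if the vertices
    -- they are dual to are `u` and `v`.
    change ¬ Γ.Adj (e (σ i)) (e (σ (finRotate _ i))) at hadj
    generalize e (σ i) = a at hadj ⊢
    generalize e (σ (finRotate _ i)) = b at hadj ⊢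
    have h1 : ¬ (u = a ∧ v = b) := by
      rintro ⟨rfl, rfl⟩
      exact hadj huv
    have h2 : ¬ (v = a ∧ u = b) := by
      rintro ⟨rfl, rfl⟩
      exact hadj huv.symm
    simp only [Pi.single_apply, ← ite_and, mul_ite, mul_one, mul_zero]
    rw [if_neg (by tauto), if_neg (by tauto)]
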